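/- **Lemma 4.1.** Let $g\ge 0$ and let $\mathbb R\langle x\rangle$ be the algebra of real noncommutative polynomials in the variables $x=(x_1,\dots,x_g)$; for a word $t=(a_1,\dots,a_m)$ of length $|t|=m$ with letters in $\{1,\dots,g\}$ put $x^t=x_{a_1}\cdots x_{a_m}$. Let $h$ be one further noncommuting variable and, for a polynomial $q$ in $x$ and $h$, let $$D[q,x_i,h]=\frac{d}{ds}\,q(x_1,\dots,x_i+sh,\dots,x_g,h)\Big|_{s=0},\qquad \mathrm{Lap}[p,h]=\sum_{i=1}^g D\bigl[D[p,x_i,h],x_i,h\bigr]\quad(p\in\mathbb R\langle x\rangle).$$ The polynomial $p$ is *harmonic* if $\mathrm{Lap}[p,h]=0$, and *subharmonic* if $\mathrm{Lap}[p,h]$ takes a (symmetric) positive semidefinite value whenever real symmetric $n\times n$ matrices $X_1,\dots,X_g,H$, of any size $n$, are substituted for $x_1,\dots,x_g,h$. For $m\ge 0$, the right neighbor decomposition of $p$ is $$p=\sum_{|t|=m}x^t p_t+\Lambda,\qquad p_t,\Lambda\in\mathbb R\langle x\rangle,\quad \deg\Lambda<m,$$ where $\deg 0=-\infty$; $p_t$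 is called the right neighbor of $x^t$. 1. If $p$ is harmonic, then for every $m\ge 0$ the right neighbor $p_t$ of each monomial $x^t$ of degree $m$ is harmonic. 2. If $p$ is subharmonic and homogeneous of degree $d$, then the right neighbor $p_t$ of each monomial $x^t$ of degree $m=d/2$ is harmonic (a statement about even $d$). -/

import Mathlib

/-! Noncommutative real polynomials are elements of the free algebra `FreeAlgebra ℝ α`
on a type `α` of variables. -/

namespace NCPoly

noncomputable section

/-- The monomial `x_{t_1} ⋯ x_{t_m}` attached to a word `t` of length `m`. -/
def monomial {α : Type} {m : ℕ} (t : Fin m → α) : FreeAlgebra ℝ α :=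
  ((List.ofFn t).map (FreeAlgebra.ι ℝ)).prod

/-- The coefficient of the monomial given by the word `w` in `p`. -/
def coeff {α : Type} (p : FreeAlgebra ℝ α) (w : FreeMonoid α) : ℝ :=
  (FreeAlgebra.basisFreeMonoid ℝ α).repr p w

/-- `p` has degree less than `m` (the zero polynomial has degree less than every `m`). -/
def DegreeLT {α : Type} (p : FreeAlgebra ℝ α) (m : ℕ) : Prop :=
  ∀ w : FreeMonoid α, coeff p w ≠ 0 → w.length < m

/-- `p` is homogeneous of degree `d`: all its monomials have length `d`. -/
def IsHomogeneous {α : Type} (p : FreeAlgebra ℝ α) (d : ℕ) : Prop :=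
  ∀ w : FreeMonoid α, coeff p w ≠ 0 → w.length = d

/-- `p(x_1, …, x_i + T h, …, x_g)` as a polynomial in a central parameter `T`, for `p` a
polynomial in the variables `x_1, …, x_g` (`some j`) and `h` (`none`). -/
def shift {g : ℕ} (i : Fin g) :
    FreeAlgebra ℝ (Option (Fin g)) →ₐ[ℝ] Polynomial (FreeAlgebra ℝ (Option (Fin g))) :=
  FreeAlgebra.lift ℝ fun v =>
    if v = some i then
      Polynomial.C (FreeAlgebra.ι ℝ (some i)) +
        Polynomial.X * Polynomial.C (FreeAlgebra.ι ℝ none)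
    else Polynomial.C (FreeAlgebra.ι ℝ v)

/-- The directional derivative `D[p, x_i, h] = d/dT p(x_1, …, x_i + T h, …, x_g)` at `T = 0`. -/
def dirDeriv {g : ℕ} (i : Fin g) (p : FreeAlgebra ℝ (Option (Fin g))) :
    FreeAlgebra ℝ (Option (Fin g)) :=
  (Polynomial.derivative (shift i p)).eval 0

/-- A polynomial in `x_1, …, x_g` regarded as a polynomial in `x_1, …, x_g, h`. -/
def incl {g : ℕ} : FreeAlgebra ℝ (Fin g) →ₐ[ℝ] FreeAlgebra ℝ (Option (Fin g)) :=
  FreeAlgebra.lift ℝ fun j => FreeAlgebra.ι ℝ (some j)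

/-- The noncommutative Laplacian `Lap[p, h] = ∑ i, D[D[p, x_i, h], x_i, h]`. -/
def lap {g : ℕ} (p : FreeAlgebra ℝ (Fin g)) : FreeAlgebra ℝ (Option (Fin g)) :=
  ∑ i : Fin g, dirDeriv i (dirDeriv i (incl p))

/-- `q` takes positive semidefinite values on all tuples of real symmetric matrices of every
size (`Matrix.PosSemidef` includes the symmetry of the value). -/
def MatrixPositive {α : Type} (q : FreeAlgebra ℝ α) : Prop :=
  ∀ (n : ℕ) (X : α → Matrix (Fin n) (Fin n) ℝ), (∀ a, (X a).IsSymm) →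
    (FreeAlgebra.lift ℝ X q).PosSemidef

/-- `p` is harmonic: its Laplacian is zero. -/
def Harmonic {g : ℕ} (p : FreeAlgebra ℝ (Fin g)) : Prop :=
  lap p = 0

/-- `p` is subharmonic: its Laplacian is matrix positive, in the variables `x` and `h`. -/
def Subharmonic {g : ℕ} (p : FreeAlgebra ℝ (Fin g)) : Prop :=
  MatrixPositive (lap p)

/-- The right neighbor decomposition `p = ∑_{|t| = m} x^t p_t + Λ` with `deg Λ < m`; the
polynomial `nb t` is the right neighbor `p_t` of `x^t`. -/
def IsRightNeighborDecomp {g : ℕ} (p : FreeAlgebra ℝ (Fin g)) (m : ℕ)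
    (nb : (Fin m → Fin g) → FreeAlgebra ℝ (Fin g)) (Λ : FreeAlgebra ℝ (Fin g)) : Prop :=
  p = ∑ t : Fin m → Fin g, monomial t * nb t + Λ ∧ DegreeLT Λ m

/-- Every polynomial has a right neighbor decomposition for every `m`. -/
theorem exists_isRightNeighborDecomp {g : ℕ} (p : FreeAlgebra ℝ (Fin g)) (m : ℕ) :
    ∃ nb Λ, IsRightNeighborDecomp p m nb Λ := by
  classical
  induction (FreeAlgebra.basisFreeMonoid ℝ (Fin g)).mem_span p using Submodule.span_induction with
  | zero => exact ⟨0, 0, by simp, fun w hw => absurd (by simp [coeff]) hw⟩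
  | add p q _ _ hp hq =>
    obtain ⟨a, L, h1, h2⟩ := hp
    obtain ⟨b, M, h3, h4⟩ := hq
    refine ⟨a + b, L + M, ?_, fun w hw => ?_⟩
    · nth_rewrite 1 [h1, h3]
      simp only [Pi.add_apply, mul_add, Finset.sum_add_distrib]
      abel
    · by_cases h : coeff L w = 0
      · refine h4 w fun h' => hw ?_
        simp only [coeff] at h h' ⊢
        simp [h, h']
      · exact h2 w h
  | smul c p _ hp =>
    obtain ⟨a, L, h1, h2⟩ := hp
    refine ⟨c • a, c • L, ?_, fun w hw => h2 w fun h => hw ?_⟩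
    · nth_rewrite 1 [h1]
      simp [Finset.smul_sum]
    · simp only [coeff] at h ⊢
      simp [h]
  | mem p hp =>
    obtain ⟨w, rfl⟩ := hp
    have hb : ∀ v : FreeMonoid (Fin g), FreeAlgebra.basisFreeMonoid ℝ (Fin g) v =
        (v.toList.map (FreeAlgebra.ι ℝ)).prod := by
      intro v
      simp [FreeAlgebra.basisFreeMonoid, FreeAlgebra.equivMonoidAlgebraFreeMonoid,
        FreeMonoid.lift_apply]
    by_cases hw : w.length < m
    · refine ⟨0, FreeAlgebra.basisFreeMonoid ℝ (Fin g) w, by simp, fun v hv => ?_⟩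
      have : w = v := by
        by_contra h
        exact hv (by simp [coeff, h])
      exact this ▸ hw
    · have hl : m ≤ w.toList.length := not_lt.mp hw
      let t : Fin m → Fin g := fun i => w.toList.get (i.castLE hl)
      have ht : List.ofFn t = w.toList.take m := by
        apply List.ext_getElem
        · simp [hl]
        · intro i h1 h2
          simp [t]
      refine ⟨Pi.single t ((w.toList.drop m).map (FreeAlgebra.ι ℝ)).prod, 0, ?_,
        fun w hw => absurd (by simp [coeff]) hw⟩
      rw [Finset.sum_eq_single t, hb, Pi.single_eq_same, monomial, ht, ← List.prod_append,
        ← List.map_append, List.take_append_drop, add_zero]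
      · intro b _ h
        simp [Pi.single_eq_of_ne h]
      · simp

end

end NCPoly

namespace NCPoly

/-! The right neighbor of `x^t` is obtained from `p` by keeping the words that begin with `t` and
deleting that prefix (`IsRightNeighborDecomp.eq_stripWord`). Differentiation either keeps a leading
letter or turns it into `h`, so deleting leading `x`-letters commutes with the Laplacian
(`lap_stripWord`). Harmonicity thus passes to right neighbors at once.

In the subharmonic case, it remains to kill the coefficient in `lap p` of each word `W = t w` of
length `2m`. Label the edges of a path on vertices `0, …, 2m` by the letters of `W` and substitute
the adjacency matrices of the letters. The `(0, 2m)` entry of the value of `lap p` is the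
coefficient of `W`, since only one walk of length `2m` joins the ends. Its `(0, 0)` entry counts
closed walks of length `2m`; these see only the first `m` edges, labeled by `t`, while every word of
`lap p` contains `h`. So this diagonal entry is zero, and positivity makes its whole row zero
(`MatrixPositive.repr_eq_zero`). -/

/-- The basis of the free algebra given by the words, indexed by lists of letters. -/
noncomputable def wordBasis (α : Type) : Module.Basis (List α) ℝ (FreeAlgebra ℝ α) :=
  (FreeAlgebra.basisFreeMonoid ℝ α).reindex FreeMonoid.toList

section Words

variable {α : Type}

theorem wordBasis_apply (l : List α) :
    wordBasis α l = (l.map (FreeAlgebra.ι ℝ)).prod := by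
  simp [wordBasis, FreeAlgebra.basisFreeMonoid, FreeAlgebra.equivMonoidAlgebraFreeMonoid,
    FreeMonoid.lift_apply]

theorem wordBasis_nil : wordBasis α [] = 1 := by
  simp [wordBasis_apply]

theorem wordBasis_cons (a : α) (l : List α) :
    wordBasis α (a :: l) = FreeAlgebra.ι ℝ a * wordBasis α l := by
  simp [wordBasis_apply]

theorem lift_wordBasis_cons {n : ℕ} (X : α → Matrix (Fin n) (Fin n) ℝ) (a : α) (l : List α) :
    FreeAlgebra.lift ℝ X (wordBasis α (a :: l)) =
      X a * FreeAlgebra.lift ℝ X (wordBasis α l) := by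
  rw [wordBasis_cons, map_mul, FreeAlgebra.lift_ι_apply]

theorem monomial_eq_wordBasis {m : ℕ} (t : Fin m → α) :
    monomial t = wordBasis α (List.ofFn t) := by
  rw [wordBasis_apply, monomial]

theorem coeff_ofList (p : FreeAlgebra ℝ α) (l : List α) :
    coeff p (FreeMonoid.ofList l) = (wordBasis α).repr p l := by
  simp [coeff, wordBasis]

theorem induction_word {M : FreeAlgebra ℝ α → Prop} (zero : M 0)
    (add : ∀ p q, M p → M q → M (p + q)) (smul : ∀ (c : ℝ) p, M p → M (c • p))
    (word : ∀ l, M (wordBasis α l)) (p : FreeAlgebra ℝ α) : M p := by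
  induction (wordBasis α).mem_span p using Submodule.span_induction with
  | zero => exact zero
  | add p q _ _ hp hq => exact add p q hp hq
  | smul c p _ hp => exact smul c p hp
  | mem p hp =>
    obtain ⟨l, rfl⟩ := hp
    exact word l

end Words

/-! ### Deleting prefixes, and right neighbors -/

section Strip

variable {α : Type} [DecidableEq α]

/-- Deletion of the first letter `a` from the words starting with `a`; all the other words are
sent to zero. -/
noncomputable def strip (a : α) : FreeAlgebra ℝ α →ₗ[ℝ] FreeAlgebra ℝ α :=
  (wordBasis α).constr ℝ fun
    | [] => 0
    | b :: l => if b = a then wordBasis α l else 0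

theorem strip_one (a : α) : strip a 1 = 0 := by
  rw [← wordBasis_nil, strip, Module.Basis.constr_basis]

theorem strip_ι_mul (a b : α) (p : FreeAlgebra ℝ α) :
    strip a (FreeAlgebra.ι ℝ b * p) = if b = a then p else 0 := by
  induction p using induction_word with
  | zero => simp
  | add p q hp hq => rw [mul_add, map_add, hp, hq]; split_ifs <;> simp
  | smul c p hp => rw [mul_smul_comm, map_smul, hp]; split_ifs <;> simp
  | word l => rw [← wordBasis_cons, strip, Module.Basis.constr_basis]

theorem repr_strip (a : α) (p : FreeAlgebra ℝ α) (l : List α) :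
    (wordBasis α).repr (strip a p) l = (wordBasis α).repr p (a :: l) := by
  induction p using induction_word with
  | zero => simp
  | add p q hp hq => simp [hp, hq]
  | smul c p hp => simp [hp]
  | word w =>
    cases w with
    | nil => rw [wordBasis_nil, strip_one, ← wordBasis_nil]; simp
    | cons b w =>
      rw [wordBasis_cons, strip_ι_mul, ← wordBasis_cons]
      by_cases h : b = a <;> simp [h, Finsupp.single_apply]

/-- Deletion of the prefix `l` from the words starting with `l`; all the other words are
sent to zero. -/
noncomputable def stripWord : List α → FreeAlgebra ℝ α →ₗ[ℝ] FreeAlgebra ℝ α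
  | [] => LinearMap.id
  | a :: l => stripWord l ∘ₗ strip a

theorem repr_stripWord (l : List α) (p : FreeAlgebra ℝ α) (w : List α) :
    (wordBasis α).repr (stripWord l p) w = (wordBasis α).repr p (l ++ w) := by
  induction l generalizing p with
  | nil => rfl
  | cons a l ih => rw [stripWord, LinearMap.comp_apply, ih, repr_strip, List.cons_append]

theorem stripWord_wordBasis_mul {l l' : List α} (h : l.length = l'.length)
    (p : FreeAlgebra ℝ α) :
    stripWord l (wordBasis α l' * p) = if l' = l then p else 0 := by
  induction l generalizing l' with
  | nil =>
    obtain rfl : l' = [] := List.length_eq_zero_iff.mp h.symm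
    simp [wordBasis_nil, stripWord]
  | cons a l ih =>
    cases l' with
    | nil => simp at h
    | cons b l' =>
      rw [wordBasis_cons, mul_assoc, stripWord, LinearMap.comp_apply, strip_ι_mul]
      by_cases hab : b = a
      · simp [hab, ih (Nat.succ.inj h)]
      · simp [hab]

end Strip

/-- The words of `Λ` are too short to have a prefix of length `m`. In particular the right neighbors
are unique. -/
theorem IsRightNeighborDecomp.eq_stripWord {g m : ℕ} {p Λ : FreeAlgebra ℝ (Fin g)}
    {nb : (Fin m → Fin g) → FreeAlgebra ℝ (Fin g)} (h : IsRightNeighborDecomp p m nb Λ)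
    (t : Fin m → Fin g) : nb t = stripWord (List.ofFn t) p := by
  have hΛ : stripWord (List.ofFn t) Λ = 0 := by
    apply (wordBasis _).repr.injective
    ext w
    rw [repr_stripWord, ← coeff_ofList, map_zero, Finsupp.zero_apply]
    by_contra hw
    have := h.2 _ hw
    simp [FreeMonoid.length] at this
  rw [h.1, map_add, hΛ, add_zero, map_sum, Finset.sum_eq_single t]
  · rw [monomial_eq_wordBasis, stripWord_wordBasis_mul rfl, if_pos rfl]
  · intro s _ hs
    rw [monomial_eq_wordBasis, stripWord_wordBasis_mul (by simp),
      if_neg fun e => hs (List.ofFn_injective e)]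
  · simp

/-! ### Directional derivatives and the Laplacian on words -/

section Derivative

variable {g : ℕ}

theorem coeff_zero_shift (i : Fin g) (p : FreeAlgebra ℝ (Option (Fin g))) :
    (shift i p).coeff 0 = p := by
  induction p using induction_word with
  | zero => simp
  | add p q hp hq => simp [hp, hq]
  | smul c p hp => simp [hp]
  | word l =>
    induction l with
    | nil => simp [wordBasis_nil]
    | cons a l ih =>
      rw [wordBasis_cons, map_mul, Polynomial.mul_coeff_zero, ih, shift, FreeAlgebra.lift_ι_apply]
      split_ifs with h <;> simp [h]

/-- In this form the Leibniz rule is the formula for the linear coefficient of a product. -/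
theorem dirDeriv_eq_coeff_one (i : Fin g) (p : FreeAlgebra ℝ (Option (Fin g))) :
    dirDeriv i p = (shift i p).coeff 1 := by
  rw [dirDeriv, ← Polynomial.coeff_zero_eq_eval_zero, Polynomial.coeff_derivative]
  simp

/-- The directional derivative as a linear map. -/
noncomputable def dirDerivₗ (i : Fin g) :
    FreeAlgebra ℝ (Option (Fin g)) →ₗ[ℝ] FreeAlgebra ℝ (Option (Fin g)) where
  toFun := dirDeriv i
  map_add' p q := by simp [dirDeriv_eq_coeff_one]
  map_smul' c p := by simp [dirDeriv_eq_coeff_one]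

theorem dirDerivₗ_apply (i : Fin g) (p : FreeAlgebra ℝ (Option (Fin g))) :
    dirDerivₗ i p = dirDeriv i p := rfl

theorem dirDerivₗ_one (i : Fin g) : dirDerivₗ i 1 = 0 := by
  rw [dirDerivₗ_apply, dirDeriv_eq_coeff_one, map_one, Polynomial.coeff_one]
  simp

theorem dirDerivₗ_ι_mul (i : Fin g) (a : Option (Fin g)) (p : FreeAlgebra ℝ (Option (Fin g))) :
    dirDerivₗ i (FreeAlgebra.ι ℝ a * p) =
      FreeAlgebra.ι ℝ a * dirDerivₗ i p +
        if a = some i then FreeAlgebra.ι ℝ none * p else 0 := by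
  simp only [dirDerivₗ_apply, dirDeriv_eq_coeff_one]
  rw [map_mul, Polynomial.mul_coeff_one, coeff_zero_shift, coeff_zero_shift, shift,
    FreeAlgebra.lift_ι_apply]
  split_ifs with h <;> simp [Polynomial.coeff_C]

/-- The extra Leibniz term starts with `h`, so it is killed by deleting an `x`-letter. -/
theorem strip_some_dirDerivₗ (i j : Fin g) (p : FreeAlgebra ℝ (Option (Fin g))) :
    strip (some j) (dirDerivₗ i p) = dirDerivₗ i (strip (some j) p) := by
  induction p using induction_word with
  | zero => simp
  | add p q hp hq => simp [hp, hq]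
  | smul c p hp => simp [hp]
  | word l =>
    cases l with
    | nil => simp [wordBasis_nil, strip_one, dirDerivₗ_one]
    | cons a l =>
      rw [wordBasis_cons, dirDerivₗ_ι_mul, map_add, strip_ι_mul, strip_ι_mul]
      split_ifs <;> simp [strip_ι_mul]

theorem incl_wordBasis (l : List (Fin g)) :
    incl (wordBasis _ l) = wordBasis _ (l.map some) := by
  induction l with
  | nil => simp [wordBasis_nil]
  | cons a l ih => rw [wordBasis_cons, map_mul, ih, incl, FreeAlgebra.lift_ι_apply, List.map_cons,
      wordBasis_cons]

theorem incl_strip (j : Fin g) (p : FreeAlgebra ℝ (Fin g)) :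
    incl (strip j p) = strip (some j) (incl p) := by
  induction p using induction_word with
  | zero => simp
  | add p q hp hq => simp [hp, hq]
  | smul c p hp => simp [hp]
  | word l =>
    cases l with
    | nil => simp [wordBasis_nil, strip_one]
    | cons a l =>
      rw [wordBasis_cons, strip_ι_mul, map_mul, incl, FreeAlgebra.lift_ι_apply, strip_ι_mul]
      by_cases h : a = j <;> simp [h]

theorem lap_eq (p : FreeAlgebra ℝ (Fin g)) :
    lap p = ∑ i : Fin g, dirDerivₗ i (dirDerivₗ i (incl p)) := rfl

theorem lap_strip (j : Fin g) (p : FreeAlgebra ℝ (Fin g)) :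
    lap (strip j p) = strip (some j) (lap p) := by
  simp only [lap_eq, map_sum, strip_some_dirDerivₗ, incl_strip]

theorem lap_stripWord (l : List (Fin g)) (p : FreeAlgebra ℝ (Fin g)) :
    lap (stripWord l p) = stripWord (l.map some) (lap p) := by
  induction l generalizing p with
  | nil => rfl
  | cons a l ih => rw [stripWord, LinearMap.comp_apply, ih, lap_strip]; rfl

/-- Every word of length `n` is sent by a directional derivative to a combination of words
of length `n` which contain the direction `h`. -/
theorem dirDerivₗ_wordBasis_mem (i : Fin g) (l : List (Option (Fin g))) :
    dirDerivₗ i (wordBasis _ l) ∈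
      Submodule.span ℝ (wordBasis _ '' {w | w.length = l.length ∧ none ∈ w}) := by
  induction l with
  | nil => simp [wordBasis_nil, dirDerivₗ_one]
  | cons a l ih =>
    rw [wordBasis_cons, dirDerivₗ_ι_mul]
    refine add_mem ?_ ?_
    · refine Submodule.span_induction (p := fun q _ => FreeAlgebra.ι ℝ a * q ∈ _) ?_ ?_ ?_ ?_ ih
      · rintro _ ⟨w, ⟨hw, hn⟩, rfl⟩
        rw [← wordBasis_cons]
        exact Submodule.subset_span ⟨_, by simp [hw, hn], rfl⟩
      · simp
      · intro p q _ _ hp hq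
        rw [mul_add]
        exact add_mem hp hq
      · intro c p _ hp
        rw [mul_smul_comm]
        exact Submodule.smul_mem _ c hp
    · split_ifs
      · rw [← wordBasis_cons]
        exact Submodule.subset_span ⟨_, by simp, rfl⟩
      · exact zero_mem _

theorem dirDerivₗ_mem {n : ℕ} (i : Fin g) {q : FreeAlgebra ℝ (Option (Fin g))}
    (hq : q ∈ Submodule.span ℝ (wordBasis _ '' {w | w.length = n})) :
    dirDerivₗ i q ∈ Submodule.span ℝ (wordBasis _ '' {w | w.length = n ∧ none ∈ w}) := by
  induction hq using Submodule.span_induction with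
  | zero => simp
  | add p q _ _ hp hq => simpa using add_mem hp hq
  | smul c p _ hp => simpa using Submodule.smul_mem _ c hp
  | mem p hp =>
    obtain ⟨w, rfl, rfl⟩ := hp
    exact dirDerivₗ_wordBasis_mem i w

theorem IsHomogeneous.lap_mem {n : ℕ} {p : FreeAlgebra ℝ (Fin g)} (hp : IsHomogeneous p n) :
    lap p ∈ Submodule.span ℝ (wordBasis _ '' {w | w.length = n ∧ none ∈ w}) := by
  have hmem : p ∈ Submodule.span ℝ (wordBasis _ '' {w | w.length = n}) := by
    rw [Module.Basis.mem_span_image]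
    intro w hw
    have := hp (FreeMonoid.ofList w) (by simpa [coeff_ofList] using hw)
    simpa [FreeMonoid.length] using this
  clear hp
  have hincl : incl p ∈ Submodule.span ℝ (wordBasis _ '' {w | w.length = n}) := by
    induction hmem using Submodule.span_induction with
    | zero => simp
    | add p q _ _ hp hq => simpa using add_mem hp hq
    | smul c p _ hp => simpa using Submodule.smul_mem _ c hp
    | mem p hp =>
      obtain ⟨w, hw, rfl⟩ := hp
      rw [incl_wordBasis]
      exact Submodule.subset_span ⟨_, by simpa using hw, rfl⟩
  rw [lap_eq]
  refine sum_mem fun i _ => dirDerivₗ_mem i ?_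
  -- The outer derivative already produces an `h`; from the inner one only the length is needed.
  exact Submodule.span_mono (Set.image_mono fun w hw => hw.1) (dirDerivₗ_mem i hincl)

end Derivative

/-! ### Walks on a labeled path -/

section PathMatrices

variable {α : Type} [DecidableEq α]

/-- For a word `W`, the adjacency matrices of the path `0 — 1 — ⋯ — n` whose edge from `k` to
`k + 1` carries the `k`-th letter of `W`: the entries for the edges with letter `a` are `1`. -/
def pathMatrix (W : List α) (n : ℕ) (a : α) : Matrix (Fin (n + 1)) (Fin (n + 1)) ℝ :=
  Matrix.of fun i j =>
    if ((i : ℕ) + 1 = j ∧ W[(i : ℕ)]? = some a) ∨ ((j : ℕ) + 1 = i ∧ W[(j : ℕ)]? = some a)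
    then 1 else 0

theorem pathMatrix_isSymm (W : List α) (n : ℕ) (a : α) : (pathMatrix W n a).IsSymm := by
  ext i j
  simp only [pathMatrix, Matrix.transpose_apply, Matrix.of_apply, or_comm]

theorem pathMatrix_ne_zero {W : List α} {n : ℕ} {a : α} {i j : Fin (n + 1)}
    (h : pathMatrix W n a i j ≠ 0) :
    ((i : ℕ) + 1 = j ∧ W[(i : ℕ)]? = some a) ∨ ((j : ℕ) + 1 = i ∧ W[(j : ℕ)]? = some a) := by
  by_contra hc
  exact h (if_neg hc)

/-- A walk on the path moves at most as far as its length. -/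
theorem lift_pathMatrix_band {W : List α} {n : ℕ} (l : List α) {i j : Fin (n + 1)}
    (h : FreeAlgebra.lift ℝ (pathMatrix W n) (wordBasis α l) i j ≠ 0) :
    (j : ℕ) ≤ i + l.length ∧ (i : ℕ) ≤ j + l.length := by
  induction l generalizing i with
  | nil =>
    rw [wordBasis_nil, map_one, Matrix.one_apply, ne_eq, ite_eq_right_iff] at h
    obtain rfl : i = j := by
      by_contra hij
      exact h fun e => absurd e hij
    simp
  | cons a l ih =>
    rw [lift_wordBasis_cons, Matrix.mul_apply] at h
    obtain ⟨k, -, hk⟩ := Finset.exists_ne_zero_of_sum_ne_zero h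
    have h1 := pathMatrix_ne_zero (left_ne_zero_of_mul hk)
    have h2 := ih (right_ne_zero_of_mul hk)
    simp only [List.length_cons]
    omega

/-- There is only one shortest walk between two vertices of the path. -/
theorem lift_pathMatrix_far {W : List α} {n : ℕ} (l : List α) {i j : Fin (n + 1)}
    (hj : (j : ℕ) = i + l.length) (hW : j ≤ W.length) :
    FreeAlgebra.lift ℝ (pathMatrix W n) (wordBasis α l) i j =
      if l = (W.drop i).take l.length then 1 else 0 := by
  induction l generalizing i with
  | nil =>
    obtain rfl : i = j := Fin.ext (by simpa using hj.symm)
    simp [wordBasis_nil]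
  | cons a l ih =>
    rw [List.length_cons] at hj
    have hi : (i : ℕ) + 1 < n + 1 := by omega
    have hiW : (i : ℕ) < W.length := by omega
    rw [lift_wordBasis_cons, Matrix.mul_apply, Finset.sum_eq_single ⟨i + 1, hi⟩]
    · rw [ih (by simp only; omega), List.drop_eq_getElem_cons hiW, List.length_cons,
        List.take_succ_cons]
      simp only [pathMatrix, Matrix.of_apply, List.getElem?_eq_getElem hiW, List.cons.injEq,
        Option.some.injEq, true_and]
      by_cases ha : W[(i : ℕ)] = a
      · simp [ha]
      · have : ¬ a = W[(i : ℕ)] := fun h => ha h.symm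
        have hi' : (i : ℕ) + 1 + 1 ≠ i := by omega
        simp [ha, this, hi']
    -- The only other neighbor of `i` is `i - 1`, from which `j` is out of reach.
    · intro k _ hk
      by_contra h
      have h1 := pathMatrix_ne_zero (left_ne_zero_of_mul h)
      have h2 := lift_pathMatrix_band l (right_ne_zero_of_mul h)
      refine hk (Fin.ext ?_)
      simp only
      omega
    · simp

/-- A closed walk of length `2 m` starting at `0` does not use the letters which occur
only after the first `m` letters of `W`. -/
theorem lift_pathMatrix_closed {W : List α} {n m : ℕ} {a : α}
    (ha : ∀ k, W[k]? = some a → m ≤ k) {l : List α} (hl : l.length ≤ 2 * m) (hal : a ∈ l) :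
    FreeAlgebra.lift ℝ (pathMatrix W n) (wordBasis α l) 0 0 = 0 := by
  obtain ⟨u, v, rfl⟩ := List.append_of_mem hal
  by_contra h
  rw [wordBasis_apply, List.map_append, List.prod_append, ← wordBasis_apply, ← wordBasis_apply,
    map_mul, lift_wordBasis_cons, Matrix.mul_apply] at h
  obtain ⟨i, -, hi⟩ := Finset.exists_ne_zero_of_sum_ne_zero h
  have h1 := lift_pathMatrix_band u (left_ne_zero_of_mul hi)
  have h' := right_ne_zero_of_mul hi
  rw [Matrix.mul_apply] at h'
  obtain ⟨j, -, hj⟩ := Finset.exists_ne_zero_of_sum_ne_zero h'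
  have h2 := lift_pathMatrix_band v (right_ne_zero_of_mul hj)
  simp only [List.length_append, List.length_cons] at hl
  simp only [Fin.val_zero] at h1 h2
  -- Crossing the edge from `k` to `k + 1` and returning to `0` takes at least `2 (k + 1)` steps,
  -- more than `2 m` when `m ≤ k`.
  rcases pathMatrix_ne_zero (left_ne_zero_of_mul hj) with ⟨e, hw⟩ | ⟨e, hw⟩
  · have := ha _ hw
    omega
  · have := ha _ hw
    omega

/-- The coefficient of `W` is an entry of the value at the path matrices of `W`. -/
theorem lift_pathMatrix_eq_repr (W : List α) {q : FreeAlgebra ℝ α}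
    (hq : q ∈ Submodule.span ℝ (wordBasis α '' {w | w.length = W.length})) :
    FreeAlgebra.lift ℝ (pathMatrix W W.length) q 0 (Fin.last _) = (wordBasis α).repr q W := by
  induction hq using Submodule.span_induction with
  | zero => simp
  | add p q _ _ hp hq => simp [hp, hq]
  | smul c p _ hp => simp [hp]
  | mem p hp =>
    obtain ⟨w, hw, rfl⟩ := hp
    rw [lift_pathMatrix_far w (by simpa using Eq.symm hw) (by simp), hw.out]
    simp [Finsupp.single_apply]

/-- For positive semidefinite `A`, a vector `v` with `vᵀ A v = 0` lies in the kernel; take `v` a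
basis vector. -/
theorem _root_.Matrix.PosSemidef.apply_eq_zero_of_diag_eq_zero {n : Type*} [Fintype n]
    [DecidableEq n] {A : Matrix n n ℝ} (hA : A.PosSemidef) {i : n} (hi : A i i = 0) (j : n) :
    A i j = 0 := by
  have h := (hA.dotProduct_mulVec_zero_iff (Pi.single i 1)).mp (by simp [hi])
  have hj := congrFun h j
  rw [← hA.isHermitian.apply i j]
  simpa using hj

/-- If all words of a matrix positive polynomial have length `2 m` and contain the letter `a`,
then the coefficients of the words without `a` in their first half vanish. -/
theorem MatrixPositive.repr_eq_zero {q : FreeAlgebra ℝ α} (hq : MatrixPositive q) {m : ℕ} {a : α}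
    (hmem : q ∈ Submodule.span ℝ (wordBasis α '' {w | w.length = 2 * m ∧ a ∈ w}))
    {W : List α} (hW : W.length = 2 * m) (ha : ∀ k, W[k]? = some a → m ≤ k) :
    (wordBasis α).repr q W = 0 := by
  have hpos := hq _ _ (pathMatrix_isSymm W W.length)
  rw [← lift_pathMatrix_eq_repr W
    (Submodule.span_mono (Set.image_mono fun w hw => hw.1.trans hW.symm) hmem)]
  refine hpos.apply_eq_zero_of_diag_eq_zero ?_ _
  clear hpos hq
  induction hmem using Submodule.span_induction with
  | zero => simp
  | add p q _ _ hp hq => simp [hp, hq]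
  | smul c p _ hp => simp [hp]
  | mem p hp =>
    obtain ⟨w, ⟨hw, haw⟩, rfl⟩ := hp
    exact lift_pathMatrix_closed ha hw.le haw

end PathMatrices

end NCPoly

theorem lemma4p1 (g : ℕ) (p : FreeAlgebra ℝ (Fin g)) :
    (NCPoly.Harmonic p →
      ∀ (m : ℕ) (nb : (Fin m → Fin g) → FreeAlgebra ℝ (Fin g)) (Λ : FreeAlgebra ℝ (Fin g)),
        NCPoly.IsRightNeighborDecomp p m nb Λ → ∀ t : Fin m → Fin g, NCPoly.Harmonic (nb t)) ∧
    (∀ d : ℕ, NCPoly.Subharmonic p → NCPoly.IsHomogeneous p d →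
      ∀ (m : ℕ) (nb : (Fin m → Fin g) → FreeAlgebra ℝ (Fin g)) (Λ : FreeAlgebra ℝ (Fin g)),
        2 * m = d → NCPoly.IsRightNeighborDecomp p m nb Λ →
          ∀ t : Fin m → Fin g, NCPoly.Harmonic (nb t)) := by
  refine ⟨fun hp m nb Λ h t => ?_, ?_⟩
  · rw [NCPoly.Harmonic, h.eq_stripWord, NCPoly.lap_stripWord, hp, map_zero]
  · rintro _ hp hd m nb Λ rfl h t
    rw [NCPoly.Harmonic, h.eq_stripWord, NCPoly.lap_stripWord]
    apply (NCPoly.wordBasis _).repr.injective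
    ext w
    rw [NCPoly.repr_stripWord, map_zero, Finsupp.zero_apply]
    have hmem := hd.lap_mem
    by_contra hne
    have hlen : ((List.ofFn t).map some ++ w).length = 2 * m :=
      (((NCPoly.wordBasis _).mem_span_image.mp hmem) (Finsupp.mem_support_iff.mpr hne)).1
    refine hne (NCPoly.MatrixPositive.repr_eq_zero hp hmem hlen fun k hk => ?_)
    -- The first `m` letters come from `t`, so none of them is `h`.
    by_contra hkm
    rw [List.getElem?_append_left (by simpa using hkm)] at hk
    simp at hk
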